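/- For a finite simple graph $\Gamma$, let $\mathrm{Spec}(\Gamma)$ be the multiset of eigenvalues of its adjacency matrix (with multiplicity), and let the energy $E(\Gamma)$ be the sum of the absolute values of these eigenvalues. Two graphs on the same finite vertex set are isospectral if their spectra coincide, and equienergetic if their energies coincide. Let $q=p^m$ with $p$ prime and $m\ge 1$. For $k\ge 1$ let $R_k=\{x^k : x\in\mathbb{F}_q^*\}$, and let the generalized Paley graph $\Gamma(k,q)$ be the Cayley graph of the additive group of $\mathbb{F}_q$ with connection set $R_k$. For $k>2$, $\Gamma(k,q)$ is called semiprimitive if $m$ is even, $k\mid p^{j}+1$ for some $j\mid \frac m2$, and $k\neq p^{m/2}+1$ (in this case $R_k=-R_k$, so $\Gamma(k,q)$ is an undirected graph without loops). Proposition. Let $\Gamma(k,q)$ be a semiprimitive generalized Paley graph with $k>2$, and let $t$ be the least non-negative integer $j$ such that $k\mid p^{j}+1$ (necessarily $t\geq 1$). Then $2t$ divides $m$, and $\Gamma(k,q)$ and its complement $\overline{\Gamma}(k,q)$ are equienergetic and non-isospectral if and only if the integer $s=\frac{m}{2t}$ is odd. -/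

import Mathlib

/-- The spectrum of a finite graph: the multiset of the eigenvalues of its real adjacency matrix,
each counted with its multiplicity. -/
noncomputable def graphSpectrum {V : Type*} [Fintype V] (G : SimpleGraph V) : Multiset ℝ := by
  classical
  exact (Finset.univ : Finset V).val.map (G.isHermitian_adjMatrix ℝ).eigenvalues

/-- The energy of a finite graph: the sum of the absolute values of its eigenvalues, taken with
multiplicity. -/
noncomputable def graphEnergy {V : Type*} [Fintype V] (G : SimpleGraph V) : ℝ :=
  ((graphSpectrum G).map (fun x => |x|)).sum

/-- Two graphs on the same finite vertex set are isospectral if they have the same spectrum. -/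
def Isospectral {V : Type*} [Fintype V] (G H : SimpleGraph V) : Prop :=
  graphSpectrum G = graphSpectrum H

/-- Two graphs on the same finite vertex set are equienergetic if they have the same energy. -/
def Equienergetic {V : Type*} [Fintype V] (G H : SimpleGraph V) : Prop :=
  graphEnergy G = graphEnergy H

/-- The set of nonzero `k`-th powers of a field. -/
def kthPowers (F : Type*) [Field F] (k : ℕ) : Set F :=
  {y | ∃ x : F, x ≠ 0 ∧ y = x ^ k}

/-- The generalized Paley graph: the Cayley graph of the additive group of `F` with respect to the
set of nonzero `k`-th powers. Distinct `u`, `v` are adjacent iff `v - u` or `u - v` is a nonzero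
`k`-th power; when `-1` is a `k`-th power the two conditions are the same. -/
def gpGraph (F : Type*) [Field F] (k : ℕ) : SimpleGraph F :=
  SimpleGraph.addCayley (kthPowers F k)

/-- The condition on `k` and `q = p ^ m` under which the generalized Paley graph is called
semiprimitive. -/
def IsSemiprimitive (k p m : ℕ) : Prop :=
  (k = 2 ∧ p ^ m ≡ 1 [MOD 4]) ∨
    (2 < k ∧ Even m ∧ (∃ t : ℕ, t ∣ m / 2 ∧ k ∣ p ^ t + 1) ∧ k ≠ p ^ (m / 2) + 1)

/-! Write `Q = p ^ t`, so that `q = Q ^ (2 * s)`. Additive characters diagonalize both graphs. The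
eigenvalue of `gpGraph F k` at `a` is `(S a - 1) / k` with `S a = ∑ ψ (a * x ^ k)`, and the
complement is expressed in the same sums. The core fact (`powSum_semiprimitive`) is that for `a ≠
0`, `S a` is `b` or `-b (k - 1)`, where `b = (-1) ^ s * Q ^ s`.

For exponent `Q + 1`, Frobenius invariance of `ψ` turns `x ^ (Q + 1)` into a Hermitian-type form.
The square of the sum is then 0 or `q` times the size of the radical (`powSum_sq`), and that size is
1 or `Q ^ 2`. Integrality forces the sum to be 1 modulo `Q + 1`; this excludes 0 and fixes the sign.
A divisor `k` of `Q + 1` follows by averaging (`powSum_average`).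

Since `∑ S a = 0` over `a ≠ 0`, the multiplicities of the two values are determined. The energies
then agree exactly when `b < 0`, that is, when `s` is odd, while the second moments of the spectra
always differ. -/

open Finset

/-! ### Power maps in finite cyclic groups. -/

section CyclicPowers

variable {G : Type*} [CommGroup G] [IsCyclic G] [Finite G]

/-- In a finite cyclic group, if `e` divides the order then the `e`-th powers are the elements
killed by the complementary divisor. -/
theorem IsCyclic.exists_pow_eq_iff {e f : ℕ} (h : e * f = Nat.card G) (u : G) :
    (∃ x : G, x ^ e = u) ↔ u ^ f = 1 := by
  have hpos : 0 < e * f := h ▸ Nat.card_pos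
  have hle : (powMonoidHom e : G →* G).range ≤ (powMonoidHom f : G →* G).ker := by
    rintro _ ⟨x, rfl⟩
    simp [MonoidHom.mem_ker, ← pow_mul, h]
  have heq := Subgroup.eq_of_le_of_card_ge hle (by
    rw [IsCyclic.card_powMonoidHom_ker, IsCyclic.card_powMonoidHom_range, ← h,
      Nat.gcd_eq_right (Dvd.intro _ rfl), Nat.gcd_eq_right (Dvd.intro_left _ rfl),
      Nat.mul_div_cancel_left _ (Nat.pos_of_mul_pos_right hpos)])
  have := SetLike.ext_iff.mp heq u
  simpa [MonoidHom.mem_ker] using this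

/-- In a finite cyclic group, an `e`-th power has exactly `e` roots of exponent `e`, for `e`
dividing the order. -/
theorem IsCyclic.ncard_pow_eq {e : ℕ} (h : e ∣ Nat.card G) {u : G} (hu : ∃ x : G, x ^ e = u) :
    Nat.card {x : G // x ^ e = u} = e := by
  obtain ⟨y, rfl⟩ := hu
  have hk := IsCyclic.card_powMonoidHom_ker (G := G) e
  rw [Nat.gcd_eq_right h] at hk
  conv_rhs => rw [← hk]
  refine Nat.card_congr ((Equiv.divRight y).subtypeEquiv fun x => ?_)
  simp [MonoidHom.mem_ker, div_pow, div_eq_one]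

/-- Summing over `e`-th powers with repetition. -/
theorem IsCyclic.sum_pow [Fintype G] [DecidableEq G] {e : ℕ} (h : e ∣ Nat.card G) {R : Type*}
    [Semiring R] (g : G → R) :
    ∑ x : G, g (x ^ e) = e * ∑ y ∈ univ.image (fun x : G => x ^ e), g y := by
  rw [← sum_fiberwise_of_maps_to (s := univ) (t := univ.image (fun x : G => x ^ e))
    (g := fun x => x ^ e) (fun x _ => mem_image_of_mem _ (mem_univ x)), mul_sum]
  refine sum_congr rfl fun y hy => ?_
  obtain ⟨x, -, hx⟩ := mem_image.mp hy
  rw [sum_congr rfl (g := fun _ => g y) (fun x hx => by rw [(mem_filter.mp hx).2]), sum_const,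
    nsmul_eq_mul]
  congr 2
  conv_rhs => rw [← IsCyclic.ncard_pow_eq h ⟨x, hx⟩]
  rw [Nat.card_eq_fintype_card, Fintype.card_subtype]

end CyclicPowers

theorem Fintype.sum_eq_add_sum_units {F M : Type*} [Field F] [Fintype F] [Fintype Fˣ]
    [AddCommMonoid M] (g : F → M) : ∑ x, g x = g 0 + ∑ u : Fˣ, g u := by
  classical
  rw [← add_sum_erase _ _ (mem_univ (0 : F))]
  congr 1
  symm
  refine sum_bij (fun u _ => (u : F)) (by simp) (fun _ _ _ _ h => Units.ext h) ?_ (by simp)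
  intro b hb
  exact ⟨Units.mk0 b (by simpa using hb), by simp, rfl⟩

/-! ### Frobenius-invariant additive characters and integrality. -/

section Character

variable {F : Type*} [Field F] [Fintype F]

/-- A finite field has a nontrivial complex additive character invariant under Frobenius. -/
theorem exists_primitive_addChar_frobenius (p : ℕ) [Fact p.Prime] [CharP F p] :
    ∃ ψ : AddChar F ℂ, ψ.IsPrimitive ∧ ∀ x, ψ (x ^ p) = ψ x := by
  let _ : Algebra (ZMod p) F := ZMod.algebra F p
  let ψ : AddChar F ℂ :=
    (ZMod.stdAddChar (N := p)).compAddMonoidHom (Algebra.trace (ZMod p) F).toAddMonoidHom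
  refine ⟨ψ, AddChar.IsPrimitive.of_ne_one ?_, fun x => ?_⟩
  · obtain ⟨a, ha⟩ : ∃ a, Algebra.trace (ZMod p) F a ≠ 0 := by
      by_contra! hcon
      exact Algebra.trace_ne_zero (ZMod p) F (LinearMap.ext hcon)
    refine AddChar.ne_one_iff.2 ⟨a, fun hf => ha ?_⟩
    exact ((ZMod.isPrimitive_stdAddChar p).zmod_char_eq_one_iff p _).mp hf
  · have h := Algebra.trace_eq_of_algEquiv
      (FiniteField.frobeniusAlgEquivOfAlgebraic (ZMod p) F) x
    simp only [FiniteField.coe_frobeniusAlgEquivOfAlgebraic, ZMod.card] at h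
    exact congrArg (ZMod.stdAddChar (N := p)) h

theorem AddChar.isIntegral_apply {A : Type*} [AddGroup A] [Finite A] (ψ : AddChar A ℂ) (a : A) :
    IsIntegral ℤ (ψ a) := by
  refine IsIntegral.of_pow (n := Nat.card A) Nat.card_pos ?_
  rw [← AddChar.map_nsmul_eq_pow, card_nsmul_eq_zero', AddChar.map_zero_eq_one]
  exact isIntegral_one

end Character

/-- A rational algebraic integer `(c - 1) / e` is an integer. -/
theorem Int.dvd_sub_one_of_isIntegral {e : ℕ} (he : e ≠ 0) {c : ℤ} {η : ℂ}
    (hη : IsIntegral ℤ η) (h : 1 + (e : ℂ) * η = c) : (e : ℤ) ∣ c - 1 := by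
  have he' : (e : ℂ) ≠ 0 := by exact_mod_cast he
  have hq : η = algebraMap ℚ ℂ ((c - 1) / e) := by
    simp only [eq_ratCast]
    push_cast
    rw [eq_div_iff he', ← h]
    ring
  rw [hq, isIntegral_algebraMap_iff (algebraMap ℚ ℂ).injective] at hη
  obtain ⟨n, hn⟩ := IsIntegrallyClosed.isIntegral_iff.mp hη
  refine ⟨n, ?_⟩
  have : (c - 1 : ℚ) = e * n := by
    have : (e : ℚ) ≠ 0 := by exact_mod_cast he
    simp only [eq_intCast] at hn
    rw [hn]; field_simp
  exact_mod_cast this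

theorem AddChar.apply_pow_primePow_eq {F : Type*} [Field F] {p : ℕ} {ψ : AddChar F ℂ}
    (hfrob : ∀ x, ψ (x ^ p) = ψ x) (t : ℕ) (x : F) :
    ψ (x ^ p ^ t) = ψ x := by
  induction t with
  | zero => simp
  | succ t ih => rw [pow_succ, pow_mul, hfrob, ih]

/-- Raising one of the two terms to the power `p ^ t` does not change `ψ`, and makes both terms
multiples of `y ^ p ^ t`. The form thus becomes additive in a single variable, ready for
orthogonality. -/
theorem AddChar.hermitian_form_eq {F : Type*} [Field F] {p t : ℕ} {ψ : AddChar F ℂ}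
    (hfrob : ∀ x, ψ (x ^ p) = ψ x) (a x y : F) :
    ψ (a * (x ^ p ^ t * y + x * y ^ p ^ t)) =
      ψ (y ^ p ^ t * (a * x + a ^ p ^ t * x ^ (p ^ t * p ^ t))) := by
  have h1 : ψ (a * x ^ p ^ t * y) = ψ ((a * x ^ p ^ t * y) ^ p ^ t) :=
    (AddChar.apply_pow_primePow_eq hfrob t _).symm
  calc ψ (a * (x ^ p ^ t * y + x * y ^ p ^ t))
      = ψ (a * x ^ p ^ t * y) * ψ (a * x * y ^ p ^ t) := by
        rw [← AddChar.map_add_eq_mul]; congr 1; ring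
    _ = ψ ((a * x ^ p ^ t * y) ^ p ^ t) * ψ (a * x * y ^ p ^ t) := by rw [h1]
    _ = _ := by
        rw [← AddChar.map_add_eq_mul]; congr 1; rw [mul_pow, mul_pow, ← pow_mul]; ring

/-! ### The Hermitian-type form and its radical. -/

section Frobenius

variable {F : Type*} [Field F] {p t : ℕ} [Fact p.Prime] [CharP F p]

theorem add_pow_primePow_add_one (x y : F) :
    (x + y) ^ (p ^ t + 1) =
      x ^ (p ^ t + 1) + y ^ (p ^ t + 1) + (x ^ p ^ t * y + x * y ^ p ^ t) := by
  rw [pow_succ, add_pow_char_pow]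
  ring

/-- The radical of the Hermitian-type form `Tr (a x ^ (p ^ t + 1))`. -/
def hermitianRadical (p t : ℕ) [Fact p.Prime] [CharP F p] (a : F) : AddSubgroup F where
  carrier := {y | a * y + a ^ p ^ t * y ^ (p ^ t * p ^ t) = 0}
  zero_mem' := by
    have := (Fact.out : p.Prime).pos.ne'
    simp [this]
  add_mem' := by
    intro x y hx hy
    simp only [Set.mem_ofPred_eq, ← pow_add] at *
    rw [add_pow_char_pow]
    linear_combination hx + hy
  neg_mem' := by
    intro x hx
    simp only [Set.mem_ofPred_eq, ← pow_add] at *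
    have h : (-x) ^ p ^ (t + t) = - x ^ p ^ (t + t) := by
      have h0 := add_pow_char_pow (p := p) (n := t + t) (-x) x
      rw [neg_add_cancel, zero_pow (pow_ne_zero _ (Fact.out : p.Prime).ne_zero)] at h0
      linear_combination -h0
    rw [h]
    linear_combination -hx

theorem mem_hermitianRadical {a y : F} :
    y ∈ hermitianRadical p t a ↔ a * y + a ^ p ^ t * y ^ (p ^ t * p ^ t) = 0 := Iff.rfl

/-- On its radical the Hermitian-type form is additive. -/
def radicalChar {ψ : AddChar F ℂ} (hfrob : ∀ x, ψ (x ^ p) = ψ x) (t : ℕ) (a : F) :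
    AddChar (hermitianRadical p t a) ℂ where
  toFun y := ψ (a * (y : F) ^ (p ^ t + 1))
  map_zero_eq_one' := by simp
  map_add_eq_mul' x y := by
    rw [AddSubgroup.coe_add, add_pow_primePow_add_one, mul_add, AddChar.map_add_eq_mul,
      AddChar.hermitian_form_eq hfrob, mem_hermitianRadical.mp x.2, mul_zero, AddChar.map_zero_eq_one,
      mul_one, mul_add, AddChar.map_add_eq_mul]

end Frobenius

/-! ### Power sums over a finite field. -/

section PowSum

variable {F : Type*} [Field F] [Fintype F]

/-- The exponential sum `∑ ψ (a x ^ e)` over a finite field. -/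
noncomputable def powSum (ψ : AddChar F ℂ) (e : ℕ) (a : F) : ℂ := ∑ x : F, ψ (a * x ^ e)

theorem Nat.card_units_field : Nat.card Fˣ = Fintype.card F - 1 := by
  rw [Nat.card_units, Nat.card_eq_fintype_card]

theorem powSum_zero (ψ : AddChar F ℂ) (e : ℕ) : powSum ψ e 0 = Fintype.card F := by
  simp [powSum]

variable [DecidableEq F]

theorem powSum_eq_one_add (ψ : AddChar F ℂ) {e : ℕ} (he : e ≠ 0) (a : F) :
    powSum ψ e a = 1 + ∑ u : Fˣ, ψ (a * (u : F) ^ e) := by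
  rw [powSum, Fintype.sum_eq_add_sum_units]
  simp [he]

theorem powSum_eq_one_add_mul (ψ : AddChar F ℂ) {e : ℕ} (he : e ≠ 0)
    (hdvd : e ∣ Fintype.card F - 1) (a : F) :
    powSum ψ e a =
      1 + e * ∑ y ∈ univ.image (fun u : Fˣ => u ^ e), ψ (a * (y : F)) := by
  rw [powSum_eq_one_add ψ he, ← IsCyclic.sum_pow (by rwa [Nat.card_units_field])
    (fun y : Fˣ => ψ (a * (y : F)))]
  simp

/-- By orthogonality the sum over all `a` is `q` times the number of roots of `x ^ e = 0`, hence
`q`, which is already the term at `a = 0`. -/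
theorem sum_units_powSum {ψ : AddChar F ℂ} (hψ : ψ.IsPrimitive) {e : ℕ} (he : e ≠ 0) :
    ∑ a : Fˣ, powSum ψ e a = 0 := by
  have h : ∑ a : F, powSum ψ e a = Fintype.card F := by
    simp only [powSum]
    rw [sum_comm]
    simp_rw [AddChar.sum_mulShift _ hψ, pow_eq_zero_iff he]
    simp
  rw [Fintype.sum_eq_add_sum_units, powSum_zero] at h
  simpa using h

/-- The integer congruence satisfied by an integer-valued power sum. -/
theorem dvd_sub_one_of_powSum_eq (ψ : AddChar F ℂ) {e : ℕ} (he : e ≠ 0)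
    (hdvd : e ∣ Fintype.card F - 1) {a : F} {c : ℤ} (h : powSum ψ e a = c) :
    (e : ℤ) ∣ c - 1 := by
  rw [powSum_eq_one_add_mul ψ he hdvd] at h
  exact Int.dvd_sub_one_of_isIntegral he
    (IsIntegral.sum _ fun y _ => ψ.isIntegral_apply _) h

/-- A power sum is an average of power sums of a multiple exponent. -/
theorem powSum_average (ψ : AddChar F ℂ) {k d : ℕ} (hk : k ≠ 0) (hd : d ≠ 0) (a : F) :
    (Fintype.card Fˣ : ℂ) * powSum ψ k a = ∑ x : Fˣ, powSum ψ (k * d) (a * (x : F) ^ k) := by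
  simp_rw [powSum_eq_one_add ψ hk, powSum_eq_one_add ψ (mul_ne_zero hk hd), sum_add_distrib]
  rw [sum_comm, mul_add]
  congr 1
  · simp
  · have : ∀ w : Fˣ, ∑ x : Fˣ, ψ (a * (x : F) ^ k * (w : F) ^ (k * d)) =
        ∑ u : Fˣ, ψ (a * (u : F) ^ k) := by
      intro w
      -- The factor `w ^ (k * d)` is absorbed into `x ^ k` by replacing `x` with `x * w ^ d`.
      refine Fintype.sum_equiv (Equiv.mulRight (w ^ d)) _ _ fun x => ?_
      simp only [Equiv.coe_mulRight, Units.val_mul, Units.val_pow_eq_pow_val]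
      congr 1
      ring
    simp [this]

variable {p t : ℕ} [Fact p.Prime] [CharP F p]

theorem powSum_sq {ψ : AddChar F ℂ} (hψ : ψ.IsPrimitive) (hfrob : ∀ x, ψ (x ^ p) = ψ x)
    (hneg : ∃ x : F, x ^ (p ^ t + 1) = -1) (a : F) :
    powSum ψ (p ^ t + 1) a ^ 2 = 0 ∨
      powSum ψ (p ^ t + 1) a ^ 2 =
        Fintype.card F * Nat.card (hermitianRadical p t a) := by
  classical
  obtain ⟨x₀, hx₀⟩ := hneg
  have hx₀' : x₀ ≠ 0 := by rintro rfl; simp at hx₀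
  -- Scaling by a root of `x ^ (p ^ t + 1) = -1` shows that the sum equals its conjugate, so its
  -- square is also its squared modulus.
  have hrefl : powSum ψ (p ^ t + 1) a = ∑ y : F, ψ (-(a * y ^ (p ^ t + 1))) := by
    rw [powSum]
    refine (Fintype.sum_equiv (Equiv.mulLeft₀ x₀ hx₀') _ _ fun x => ?_).symm
    simp [mul_pow, hx₀]
  have hinner : ∀ z : F, ∑ y : F, ψ (a * (z ^ p ^ t * y + z * y ^ p ^ t)) =
      if z ∈ hermitianRadical p t a then (Fintype.card F : ℂ) else 0 := by
    intro z
    simp_rw [AddChar.hermitian_form_eq hfrob]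
    have hb := (bijective_iterateFrobenius (R := F) (p := p) (n := t))
    rw [Fintype.sum_bijective (fun x : F => x ^ p ^ t) hb
      (fun x => ψ (x ^ p ^ t * (a * z + a ^ p ^ t * z ^ (p ^ t * p ^ t))))
      (fun y => ψ (y * (a * z + a ^ p ^ t * z ^ (p ^ t * p ^ t)))) (fun _ => rfl),
      AddChar.sum_mulShift _ hψ]
    simp [mem_hermitianRadical]
  have key : powSum ψ (p ^ t + 1) a ^ 2 =
      Fintype.card F * ∑ z : hermitianRadical p t a, radicalChar hfrob t a z := by
    calc powSum ψ (p ^ t + 1) a ^ 2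
        = ∑ y : F, ∑ x : F, ψ (a * x ^ (p ^ t + 1)) * ψ (-(a * y ^ (p ^ t + 1))) := by
          rw [sq]; nth_rw 2 [hrefl]
          rw [powSum, sum_mul_sum, sum_comm]
      -- With `x = z + y`, the terms in `y` alone cancel; the sum over `y` then vanishes unless `z`
      -- is in the radical.
      _ = ∑ y : F, ∑ z : F, ψ (a * z ^ (p ^ t + 1)) *
            ψ (a * (z ^ p ^ t * y + z * y ^ p ^ t)) := by
          refine sum_congr rfl fun y _ => ?_
          refine (Fintype.sum_equiv (Equiv.addRight y) _ _ fun z => ?_).symm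
          rw [Equiv.coe_addRight, ← AddChar.map_add_eq_mul, ← AddChar.map_add_eq_mul,
            add_pow_primePow_add_one]
          congr 1; ring
      _ = ∑ z : F, ψ (a * z ^ (p ^ t + 1)) *
            if z ∈ hermitianRadical p t a then (Fintype.card F : ℂ) else 0 := by
          rw [sum_comm]; simp_rw [← mul_sum, hinner]
      _ = _ := by
          simp_rw [mul_ite, mul_zero]
          rw [← sum_filter, ← sum_mul, mul_comm]
          congr 1
          exact sum_subtype _ (fun x => by simp) _
  rw [key, AddChar.sum_eq_ite]
  split_ifs
  · right; rw [Nat.card_eq_fintype_card]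
  · left; simp

end PowSum

/-- Modulo `Q + 1` one has `Q = -1`, and the signs 1 and -1 remain distinct because `Q + 1 > 2`. -/
theorem eq_neg_one_pow_of_dvd {Q e : ℕ} (hQ : 2 ≤ Q) {ε : ℤ} (hε : ε = 1 ∨ ε = -1)
    (h : ((Q + 1 : ℕ) : ℤ) ∣ ε * (Q : ℤ) ^ e - 1) : ε = (-1) ^ e := by
  have h1 : ((Q + 1 : ℕ) : ℤ) ∣ (Q : ℤ) ^ e - (-1) ^ e := by
    have := sub_dvd_pow_sub_pow (Q : ℤ) (-1) e
    push_cast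
    simpa using this
  have h2 : ((Q + 1 : ℕ) : ℤ) ∣ ε * (-1) ^ e - 1 := by
    have := h.sub (h1.mul_left ε)
    ring_nf at this ⊢
    exact this
  have hlarge : ∀ n : ℤ, ((Q + 1 : ℕ) : ℤ) ∣ n → |n| ≤ 2 → n = 0 := by
    intro n hn hle
    refine Int.eq_zero_of_abs_lt_dvd hn ?_
    push_cast
    have : (2 : ℤ) ≤ Q := by exact_mod_cast hQ
    omega
  have h3 := hlarge _ h2 (by
    rcases hε with rfl | rfl <;> rcases neg_one_pow_eq_or ℤ e with h | h <;> rw [h] <;> norm_num)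
  rcases hε with rfl | rfl <;> rcases neg_one_pow_eq_or ℤ e with h | h <;> rw [h] at h3 ⊢ <;>
    norm_num at h3

/-- A power sum of exponent `p ^ t + 1` whose square is `p ^ (2 t e)` equals
`(-1) ^ e p ^ (t e)`. -/
theorem powSum_eq_of_sq_eq {F : Type*} [Field F] [Fintype F] [DecidableEq F] {p t : ℕ}
    [Fact p.Prime] (ψ : AddChar F ℂ) (ht : t ≠ 0)
    (hdvd : p ^ t + 1 ∣ Fintype.card F - 1) {e : ℕ} {a : F}
    (h : powSum ψ (p ^ t + 1) a ^ 2 = (((p ^ t : ℕ) : ℂ) ^ e) ^ 2) :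
    powSum ψ (p ^ t + 1) a = (-1) ^ e * ((p ^ t : ℕ) : ℂ) ^ e := by
  have hQ : 2 ≤ p ^ t := (Fact.out : p.Prime).two_le.trans (Nat.le_self_pow ht p)
  obtain ⟨ε, hε, hS⟩ : ∃ ε : ℤ, (ε = 1 ∨ ε = -1) ∧
      powSum ψ (p ^ t + 1) a = ((ε * ((p ^ t : ℕ) : ℤ) ^ e : ℤ) : ℂ) := by
    rcases sq_eq_sq_iff_eq_or_eq_neg.mp h with h | h
    · exact ⟨1, Or.inl rfl, by rw [h]; push_cast; ring⟩
    · exact ⟨-1, Or.inr rfl, by rw [h]; push_cast; ring⟩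
  have := eq_neg_one_pow_of_dvd hQ hε (dvd_sub_one_of_powSum_eq ψ (Nat.succ_ne_zero _) hdvd hS)
  rw [hS, this]
  push_cast
  ring

theorem exists_pow_eq_neg_one {F : Type*} [Field F] [Fintype F] {p t : ℕ} [Fact p.Prime]
    [CharP F p] {r : ℕ} (hcard : Fintype.card F = (p ^ t * p ^ t - 1) * r + 1) :
    ∃ x : F, x ^ (p ^ t + 1) = -1 := by
  have hM : (p ^ t + 1) * ((p ^ t - 1) * r) = Nat.card Fˣ := by
    rw [Nat.card_units_field, hcard, Nat.add_sub_cancel, ← mul_assoc, ← Nat.sq_sub_sq, sq, one_pow]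
  obtain ⟨x, hx⟩ := (IsCyclic.exists_pow_eq_iff hM (-1)).mpr (by
    rcases (Fact.out : p.Prime).eq_two_or_odd' with rfl | hodd
    · have : (-1 : Fˣ) = 1 := Units.ext (by simp [CharTwo.neg_eq])
      simp [this]
    · exact ((Nat.Odd.sub_odd hodd.pow odd_one).mul_right r).neg_one_pow)
  exact ⟨x, by simpa using congrArg Units.val hx⟩

/-! ### Evaluation of the power sums. -/

section Semiprimitive

variable {F : Type*} [Field F] [Fintype F] [DecidableEq F] {p t s : ℕ} [Fact p.Prime] [CharP F p]

/-- The 1 counts the zero element; for a unit `u`, the radical equation can be divided by `a * u`.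
-/
theorem card_hermitianRadical (a : Fˣ) :
    Nat.card (hermitianRadical p t (a : F)) =
      1 + Nat.card {u : Fˣ // u ^ (p ^ t * p ^ t - 1) = -(a⁻¹) ^ (p ^ t - 1)} := by
  classical
  have hp := (Fact.out : p.Prime).pos
  obtain ⟨Q, hQ⟩ : ∃ Q, p ^ t = Q + 1 := ⟨p ^ t - 1, by have := Nat.pow_pos (n := t) hp; omega⟩
  obtain ⟨R, hR⟩ : ∃ R, p ^ t * p ^ t = R + 1 := ⟨p ^ t * p ^ t - 1, by
    have := Nat.mul_pos (Nat.pow_pos (n := t) hp) (Nat.pow_pos (n := t) hp); omega⟩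
  have hmem : ∀ u : Fˣ, (u : F) ∈ hermitianRadical p t (a : F) ↔
      u ^ (p ^ t * p ^ t - 1) = -(a⁻¹) ^ (p ^ t - 1) := by
    intro u
    rw [mem_hermitianRadical, hR, hQ, Nat.add_sub_cancel, Nat.add_sub_cancel, inv_pow,
      ← mul_right_inj (a ^ Q), mul_neg, mul_inv_cancel, Units.ext_iff]
    simp only [Units.val_mul, Units.val_pow_eq_pow_val, Units.val_neg, Units.val_one]
    have hau : (a : F) * u ≠ 0 := mul_ne_zero a.ne_zero u.ne_zero
    constructor
    · intro h
      refine mul_left_cancel₀ hau ?_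
      linear_combination h
    · intro h
      linear_combination (a : F) * u * h
  rw [Nat.card_eq_fintype_card, Fintype.card_subtype, card_filter,
    Fintype.sum_eq_add_sum_units, if_pos (zero_mem _), Nat.card_eq_fintype_card,
    Fintype.card_subtype, card_filter]
  simp_rw [hmem]

theorem powSum_primePow_add_one {ψ : AddChar F ℂ} (hψ : ψ.IsPrimitive)
    (hfrob : ∀ x, ψ (x ^ p) = ψ x) (ht : t ≠ 0) {r : ℕ}
    (hcard : Fintype.card F = (p ^ t) ^ (2 * s))
    (hr : Fintype.card F = (p ^ t * p ^ t - 1) * r + 1) (a : Fˣ) :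
    powSum ψ (p ^ t + 1) (a : F) =
      if a ^ ((p ^ t - 1) * r) = (-1) ^ r then (-1) ^ (s + 1) * ((p ^ t : ℕ) : ℂ) ^ (s + 1)
      else (-1) ^ s * ((p ^ t : ℕ) : ℂ) ^ s := by
  have hQ : 2 ≤ p ^ t := (Fact.out : p.Prime).two_le.trans (Nat.le_self_pow ht p)
  have hcardF : (p ^ t * p ^ t - 1) * r = Nat.card Fˣ := by
    rw [Nat.card_units_field, hr, Nat.add_sub_cancel]
  have hfac : p ^ t * p ^ t - 1 = (p ^ t + 1) * (p ^ t - 1) := by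
    rw [← Nat.sq_sub_sq, sq, one_pow]
  have hdvd : p ^ t + 1 ∣ Fintype.card F - 1 := by
    rw [hr, Nat.add_sub_cancel, hfac, mul_assoc]; exact dvd_mul_right _ _
  have hsq : powSum ψ (p ^ t + 1) (a : F) ^ 2 =
      Fintype.card F * Nat.card (hermitianRadical p t (a : F)) := by
    -- A vanishing sum would give `p ^ t + 1 ∣ 1` by the integrality congruence.
    refine (powSum_sq hψ hfrob (exists_pow_eq_neg_one hr) (a : F)).resolve_left fun h => ?_
    have h0 : powSum ψ (p ^ t + 1) (a : F) = ((0 : ℤ) : ℂ) := by simpa using h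
    have := dvd_sub_one_of_powSum_eq ψ (Nat.succ_ne_zero _) hdvd h0
    rw [zero_sub, dvd_neg] at this
    have := Int.le_of_dvd one_pos this
    push_cast at this
    have : (2 : ℤ) ≤ p ^ t := by exact_mod_cast hQ
    omega
  rw [card_hermitianRadical, hcard] at hsq
  have hiff : (∃ u : Fˣ, u ^ (p ^ t * p ^ t - 1) = -(a⁻¹) ^ (p ^ t - 1)) ↔
      a ^ ((p ^ t - 1) * r) = (-1) ^ r := by
    rw [IsCyclic.exists_pow_eq_iff hcardF, neg_pow, ← pow_mul, inv_pow, mul_inv_eq_one, eq_comm]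
  split_ifs with h
  · refine powSum_eq_of_sq_eq ψ ht hdvd ?_
    rw [IsCyclic.ncard_pow_eq (Dvd.intro _ hcardF) (hiff.mpr h)] at hsq
    rw [hsq, Nat.add_sub_cancel' (by nlinarith)]
    push_cast
    ring
  · refine powSum_eq_of_sq_eq ψ ht hdvd ?_
    have : IsEmpty {u : Fˣ // u ^ (p ^ t * p ^ t - 1) = -(a⁻¹) ^ (p ^ t - 1)} :=
      ⟨fun u => h (hiff.mp ⟨u, u.2⟩)⟩
    rw [Nat.card_of_isEmpty] at hsq
    rw [hsq]
    push_cast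
    ring

/-- In the semiprimitive case the power sums take only two values. -/
theorem powSum_semiprimitive {ψ : AddChar F ℂ} (hψ : ψ.IsPrimitive)
    (hfrob : ∀ x, ψ (x ^ p) = ψ x) (ht : t ≠ 0) {r k d : ℕ} (hkd : k * d = p ^ t + 1)
    (hcard : Fintype.card F = (p ^ t) ^ (2 * s))
    (hr : Fintype.card F = (p ^ t * p ^ t - 1) * r + 1) (a : Fˣ) :
    powSum ψ k (a : F) = (-1) ^ s * ((p ^ t : ℕ) : ℂ) ^ s ∨
      powSum ψ k (a : F) = -((-1) ^ s * ((p ^ t : ℕ) : ℂ) ^ s * (k - 1)) := by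
  have hk : k ≠ 0 := by rintro rfl; simp at hkd
  have hd : d ≠ 0 := by rintro rfl; simp at hkd
  have hfac : p ^ t * p ^ t - 1 = (p ^ t + 1) * (p ^ t - 1) := by
    rw [← Nat.sq_sub_sq, sq, one_pow]
  have hM : d * (k * (k * ((p ^ t - 1) * r))) = k * Nat.card Fˣ := by
    rw [Nat.card_units_field, hr, Nat.add_sub_cancel, hfac, ← hkd]; ring
  have hM' : d * (k * ((p ^ t - 1) * r)) = Nat.card Fˣ := by
    refine Nat.eq_of_mul_eq_mul_left (Nat.pos_of_ne_zero hk) ?_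
    rw [← hM]; ring
  have hpos : (Fintype.card Fˣ : ℂ) ≠ 0 := by exact_mod_cast Fintype.card_ne_zero
  set B : ℂ := (-1) ^ s * ((p ^ t : ℕ) : ℂ) ^ s with hB
  -- The exceptional value in `powSum_primePow_add_one` at `a * x ^ k` occurs exactly when `x ^ (k *
  -- ((p ^ t - 1) * r)) = c`. This has no solution or a proportion `1 / d` of the units, which gives
  -- the two averages.
  set c : Fˣ := (a⁻¹) ^ ((p ^ t - 1) * r) * (-1) ^ r
  have hterm : ∀ x : Fˣ, powSum ψ (k * d) ((a : F) * (x : F) ^ k) =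
      B - if x ^ (k * ((p ^ t - 1) * r)) = c then B * (k * d) else 0 := by
    intro x
    have := powSum_primePow_add_one (s := s) hψ hfrob ht hcard hr (a * x ^ k)
    have hkd' : (k * d : ℂ) = (p ^ t : ℕ) + 1 := by exact_mod_cast hkd
    rw [hkd]
    rw [Units.val_mul, Units.val_pow_eq_pow_val] at this
    rw [this]
    have hiff : (a * x ^ k) ^ ((p ^ t - 1) * r) = (-1) ^ r ↔
        x ^ (k * ((p ^ t - 1) * r)) = c := by
      simp only [c, mul_pow, ← pow_mul, inv_pow, eq_inv_mul_iff_mul_eq]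
    simp only [hiff, hkd']
    split_ifs
    · rw [hB]; ring
    · ring
  have havg := powSum_average ψ hk hd (a : F)
  simp_rw [hterm] at havg
  rw [sum_sub_distrib, ← sum_filter, sum_const, sum_const, card_univ, nsmul_eq_mul,
    nsmul_eq_mul, ← Fintype.card_subtype, ← Nat.card_eq_fintype_card
      (α := {x : Fˣ // x ^ (k * ((p ^ t - 1) * r)) = c})] at havg
  by_cases h : ∃ x : Fˣ, x ^ (k * ((p ^ t - 1) * r)) = c
  · right
    rw [IsCyclic.ncard_pow_eq (Dvd.intro_left _ hM') h] at havg
    have hM'' : (d : ℂ) * (k * ((p ^ t - 1 : ℕ) * r)) = Fintype.card Fˣ := by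
      rw [← Nat.card_eq_fintype_card]
      exact_mod_cast hM'
    refine mul_left_cancel₀ hpos (havg.trans ?_)
    push_cast
    rw [← hM'']
    ring
  · left
    have : IsEmpty {x : Fˣ // x ^ (k * ((p ^ t - 1) * r)) = c} := ⟨fun u => h ⟨u, u.2⟩⟩
    rw [Nat.card_of_isEmpty] at havg
    refine mul_left_cancel₀ hpos (havg.trans ?_)
    simp

end Semiprimitive

/-! ### Spectra of graphs determined by differences. -/

section CayleySpectrum

open Polynomial

variable {F : Type*} [Field F] [Fintype F] [DecidableEq F]

/-- The characteristic polynomial of a matrix that depends only on the difference of its indices,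
by diagonalization in the basis of additive characters. -/
theorem charpoly_of_adj_iff_sub_mem {ψ : AddChar F ℂ} (hψ : ψ.IsPrimitive) (G : SimpleGraph F)
    [DecidableRel G.Adj] (T : Finset F) (hT : ∀ u v, G.Adj u v ↔ v - u ∈ T) :
    (G.adjMatrix ℂ).charpoly = ∏ a : F, (X - C (∑ y ∈ T, ψ (a * y))) := by
  -- `P` is the character table and `P'` its inverse by orthogonality.
  let P : Matrix F F ℂ := Matrix.of fun u a => ψ (a * u)
  let P' : Matrix F F ℂ := Matrix.of fun a u => (Fintype.card F : ℂ)⁻¹ * ψ (-(a * u))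
  let D : Matrix F F ℂ := Matrix.diagonal fun a => ∑ y ∈ T, ψ (a * y)
  have hq : (Fintype.card F : ℂ) ≠ 0 := by exact_mod_cast Fintype.card_ne_zero
  have hPP' : P * P' = 1 := by
    ext u v
    simp only [P, P', Matrix.mul_apply, Matrix.of_apply, Matrix.one_apply]
    have : ∀ a : F, ψ (a * u) * ((Fintype.card F : ℂ)⁻¹ * ψ (-(a * v))) =
        (Fintype.card F : ℂ)⁻¹ * ψ (a * (u - v)) := by
      intro a
      rw [mul_left_comm, ← AddChar.map_add_eq_mul]
      congr 2; ring
    simp_rw [this, ← mul_sum, AddChar.sum_mulShift _ hψ, sub_eq_zero]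
    split_ifs <;> simp [hq]
  have hAP : G.adjMatrix ℂ * P = P * D := by
    ext u a
    rw [Matrix.mul_diagonal]
    simp only [P, Matrix.mul_apply, Matrix.of_apply,
      SimpleGraph.adjMatrix_apply, ite_mul, one_mul, zero_mul, hT]
    rw [← sum_filter, mul_sum]
    refine sum_bij (fun v _ => v - u) (by simp) (by simp) (fun y hy => ⟨y + u, by simpa⟩) ?_
    intro v _
    rw [← AddChar.map_add_eq_mul]
    congr 1; ring
  have hA : G.adjMatrix ℂ = P * (D * P') := by
    rw [← mul_assoc, ← hAP, mul_assoc, hPP', mul_one]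
  rw [hA, Matrix.charpoly_mul_comm, mul_assoc, mul_eq_one_comm.mp hPP', mul_one,
    Matrix.charpoly_diagonal]

/-- The spectrum of a graph whose adjacency depends only on the difference of the vertices. -/
theorem graphSpectrum_of_adj_iff_sub_mem {ψ : AddChar F ℂ} (hψ : ψ.IsPrimitive)
    (G : SimpleGraph F) (T : Finset F) (hT : ∀ u v, G.Adj u v ↔ v - u ∈ T) (l : F → ℝ)
    (hl : ∀ a, (l a : ℂ) = ∑ y ∈ T, ψ (a * y)) :
    graphSpectrum G = (univ : Finset F).val.map l := by
  classical
  have hroots : (G.adjMatrix ℝ).charpoly = ∏ a : F, (X - C (l a)) := by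
    refine Polynomial.map_injective Complex.ofRealHom Complex.ofReal_injective ?_
    rw [← Matrix.charpoly_map, Polynomial.map_prod]
    have : (G.adjMatrix ℝ).map Complex.ofRealHom = G.adjMatrix ℂ := by
      ext u v
      simp [SimpleGraph.adjMatrix_apply, apply_ite]
    rw [this, charpoly_of_adj_iff_sub_mem hψ G T hT]
    simp [hl]
  have h := (G.isHermitian_adjMatrix ℝ).roots_charpoly_eq_eigenvalues
  have hmap : univ.val.map (fun a => X - C (l a)) =
      ((univ : Finset F).val.map l).map fun r => X - C r := by
    rw [Multiset.map_map]
    rfl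
  rw [hroots, Finset.prod_eq_multiset_prod, hmap, roots_multiset_prod_X_sub_C] at h
  exact h.symm

theorem graphEnergy_eq_sum {V : Type*} [Fintype V] {G : SimpleGraph V} {l : V → ℝ}
    (h : graphSpectrum G = (univ : Finset V).val.map l) : graphEnergy G = ∑ a, |l a| := by
  rw [graphEnergy, h, Multiset.map_map]
  rfl

theorem Isospectral.sum_eq {V : Type*} [Fintype V] {G H : SimpleGraph V} {l l' : V → ℝ}
    (hG : graphSpectrum G = (univ : Finset V).val.map l)
    (hH : graphSpectrum H = (univ : Finset V).val.map l') (h : Isospectral G H) (g : ℝ → ℝ) :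
    ∑ a, g (l a) = ∑ a, g (l' a) := by
  rw [Isospectral, hG, hH] at h
  have := congrArg (fun M : Multiset ℝ => (M.map g).sum) h
  simpa [Multiset.map_map] using this

end CayleySpectrum

/-! ### Spectra of the Paley graph and its complement. -/

section PaleySpectrum

variable {F : Type*} [Field F] [Fintype F] [DecidableEq F]

/-- The nonzero `k`-th powers as a finite set. -/
def kthPowersFinset (F : Type*) [Field F] [Fintype F] [DecidableEq F] (k : ℕ) : Finset F :=
  univ.image fun u : Fˣ => (u : F) ^ k

theorem mem_kthPowersFinset {k : ℕ} {y : F} : y ∈ kthPowersFinset F k ↔ y ∈ kthPowers F k := by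
  simp only [kthPowersFinset, mem_image, mem_univ, true_and, kthPowers, Set.mem_ofPred_eq]
  constructor
  · rintro ⟨u, rfl⟩
    exact ⟨u, u.ne_zero, rfl⟩
  · rintro ⟨x, hx, rfl⟩
    exact ⟨Units.mk0 x hx, rfl⟩

theorem zero_notMem_kthPowersFinset {k : ℕ} : (0 : F) ∉ kthPowersFinset F k := by
  simp [kthPowersFinset]

theorem neg_mem_kthPowersFinset {k : ℕ} (hk : k ≠ 0) (hneg : ∃ x : F, x ^ k = -1) {y : F}
    (hy : y ∈ kthPowersFinset F k) : -y ∈ kthPowersFinset F k := by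
  rw [mem_kthPowersFinset] at *
  obtain ⟨x₀, h₀⟩ := hneg
  obtain ⟨x, hx, rfl⟩ := hy
  have hx₀ : x₀ ≠ 0 := by
    rintro rfl
    simp [zero_pow hk] at h₀
  exact ⟨x₀ * x, mul_ne_zero hx₀ hx, by rw [mul_pow, h₀, neg_one_mul]⟩

theorem gpGraph_adj_iff {k : ℕ} (hk : k ≠ 0) (hneg : ∃ x : F, x ^ k = -1) (u v : F) :
    (gpGraph F k).Adj u v ↔ v - u ∈ kthPowersFinset F k := by
  rw [gpGraph, SimpleGraph.addCayley_adj, ← mem_kthPowersFinset, ← mem_kthPowersFinset,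
    neg_add_eq_sub, neg_add_eq_sub]
  constructor
  · rintro ⟨-, h | h⟩
    · exact h
    · simpa using neg_mem_kthPowersFinset hk hneg h
  · intro h
    refine ⟨?_, Or.inl h⟩
    rintro rfl
    exact zero_notMem_kthPowersFinset (by simpa using h)

theorem gpGraph_compl_adj_iff {k : ℕ} (hk : k ≠ 0) (hneg : ∃ x : F, x ^ k = -1) (u v : F) :
    (gpGraph F k)ᶜ.Adj u v ↔ v - u ∈ (insert 0 (kthPowersFinset F k))ᶜ := by
  rw [SimpleGraph.compl_adj, gpGraph_adj_iff hk hneg, mem_compl, mem_insert, not_or, sub_eq_zero,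
    ne_comm]

theorem powSum_eq_one_add_mul_sum (ψ : AddChar F ℂ) {k : ℕ} (hk : k ≠ 0)
    (hdvd : k ∣ Fintype.card F - 1) (a : F) :
    powSum ψ k a = 1 + k * ∑ y ∈ kthPowersFinset F k, ψ (a * y) := by
  rw [powSum_eq_one_add_mul ψ hk hdvd]
  have : kthPowersFinset F k = (univ.image fun u : Fˣ => u ^ k).image Units.val := by
    rw [kthPowersFinset, image_image]; rfl
  rw [this, sum_image fun _ _ _ _ h => Units.ext h]

/-- The spectrum of a generalized Paley graph in terms of power sums. -/
theorem graphSpectrum_gpGraph {ψ : AddChar F ℂ} (hψ : ψ.IsPrimitive) {k : ℕ} (hk : k ≠ 0)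
    (hdvd : k ∣ Fintype.card F - 1) (hneg : ∃ x : F, x ^ k = -1) {μ : F → ℝ}
    (hμ : ∀ a, (μ a : ℂ) = powSum ψ k a) :
    graphSpectrum (gpGraph F k) = (univ : Finset F).val.map fun a => (μ a - 1) / k := by
  have hk' : (k : ℂ) ≠ 0 := by exact_mod_cast hk
  refine graphSpectrum_of_adj_iff_sub_mem hψ _ _ (gpGraph_adj_iff hk hneg) _ fun a => ?_
  push_cast
  rw [hμ, powSum_eq_one_add_mul_sum ψ hk hdvd]
  field_simp
  ring

/-- The spectrum of the complement of a generalized Paley graph in terms of power sums. -/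
theorem graphSpectrum_gpGraph_compl {ψ : AddChar F ℂ} (hψ : ψ.IsPrimitive) {k : ℕ} (hk : k ≠ 0)
    (hdvd : k ∣ Fintype.card F - 1) (hneg : ∃ x : F, x ^ k = -1) {μ : F → ℝ}
    (hμ : ∀ a, (μ a : ℂ) = powSum ψ k a) :
    graphSpectrum (gpGraph F k)ᶜ = (univ : Finset F).val.map fun a =>
      (if a = 0 then (Fintype.card F : ℝ) else 0) - (k - 1 + μ a) / k := by
  have hk' : (k : ℂ) ≠ 0 := by exact_mod_cast hk
  refine graphSpectrum_of_adj_iff_sub_mem hψ _ _ (gpGraph_compl_adj_iff hk hneg) _ fun a => ?_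
  have htot : ∑ y : F, ψ (a * y) = if a = 0 then (Fintype.card F : ℂ) else 0 := by
    simp_rw [mul_comm a]
    rw [AddChar.sum_mulShift _ hψ]
    simp
  rw [← sum_compl_add_sum (insert 0 (kthPowersFinset F k)),
    sum_insert zero_notMem_kthPowersFinset, mul_zero, AddChar.map_zero_eq_one] at htot
  push_cast
  rw [apply_ite Complex.ofReal, Complex.ofReal_natCast, Complex.ofReal_zero, ← htot, hμ,
    powSum_eq_one_add_mul_sum ψ hk hdvd]
  field_simp
  ring

end PaleySpectrum

/-! ### Divisibility by the least exponent. -/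

section Arithmetic

/-- If `t` is the least exponent with `k ∣ p ^ t + 1`, then it divides every such exponent. -/
theorem IsLeast.dvd_of_dvd_pow_add_one {k p t j : ℕ} (ht : IsLeast {j : ℕ | k ∣ p ^ j + 1} t)
    (ht0 : t ≠ 0) (hj : k ∣ p ^ j + 1) : t ∣ j := by
  have hcast : ∀ i, k ∣ p ^ i + 1 ↔ (p : ZMod k) ^ i = -1 := fun i => by
    rw [← ZMod.natCast_eq_zero_iff, eq_neg_iff_add_eq_zero]
    push_cast
    rfl
  have htk : (p : ZMod k) ^ t = -1 := (hcast t).mp ht.1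
  have hmin : ∀ i, (p : ZMod k) ^ i = -1 → t ≤ i := fun i hi => ht.2 ((hcast i).mpr hi)
  have hlt : j % t < t := Nat.mod_lt _ (Nat.pos_of_ne_zero ht0)
  have hjk : (-1) ^ (j / t) * (p : ZMod k) ^ (j % t) = -1 := by
    rw [← htk, ← pow_mul, ← pow_add, Nat.div_add_mod, htk]
    exact (hcast j).mp hj
  rcases neg_one_pow_eq_or (ZMod k) (j / t) with h | h
  · rw [h, one_mul] at hjk
    exact absurd (hmin _ hjk) (not_le.mpr hlt)
  -- Here `p ^ (j % t) = 1`, so a nonzero remainder would make `t - j % t` a smaller admissible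
  -- exponent.
  · rw [h, neg_one_mul, neg_inj] at hjk
    refine Nat.dvd_of_mod_eq_zero ?_
    by_contra hne
    have : (p : ZMod k) ^ (t - j % t) = -1 := by
      rw [← htk, ← Nat.sub_add_cancel hlt.le, pow_add, Nat.sub_add_cancel hlt.le, hjk, mul_one]
    have := hmin _ this
    omega

end Arithmetic

/-! ### Moments of two-valued functions. -/

section TwoValued

variable {F : Type*} [Field F] [Fintype F] [DecidableEq F]

/-- Sums of functions of a two-valued function on the units with zero sum. -/
theorem sum_units_comp_of_two_valued {μ : F → ℝ} {b K n : ℝ} (hb : b ≠ 0) (hK : K ≠ 0)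
    (hval : ∀ a : Fˣ, μ a = b ∨ μ a = -(b * (K - 1))) (hsum : ∑ a : Fˣ, μ a = 0)
    (hn : (Fintype.card Fˣ : ℝ) = K * n) (g : ℝ → ℝ) :
    ∑ a : Fˣ, g (μ a) = n * ((K - 1) * g b + g (-(b * (K - 1)))) := by
  -- On two points every function is affine: this is linear interpolation, where `K * b` is the gap
  -- between the values.
  have h : ∀ a : Fˣ, K * b * g (μ a) = b * ((K - 1) * g b + g (-(b * (K - 1)))) +
      (g b - g (-(b * (K - 1)))) * μ a := by
    intro a
    rcases hval a with h | h <;> rw [h] <;> ring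
  refine mul_left_cancel₀ (mul_ne_zero hK hb) ?_
  rw [mul_sum, sum_congr rfl fun a _ => h a, sum_add_distrib, ← mul_sum, ← mul_sum, hsum,
    sum_const,
    card_univ, nsmul_eq_mul, hn]
  ring

end TwoValued

/-! ### Comparison of energies and second moments. -/

section Energy

variable {F : Type*} [Field F] [Fintype F] [DecidableEq F]

/-- For a generalized Paley graph whose nontrivial power sums take the two values `b` and
`-b (k - 1)` with `b ^ 2` the order of the field, a comparison of the energy with that of the
complement, and non-isospectrality. -/
theorem equienergetic_iff_and_not_isospectral {ψ : AddChar F ℂ} (hψ : ψ.IsPrimitive) {k : ℕ}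
    (hk : 2 < k) (hdvd : k ∣ Fintype.card F - 1) (hneg : ∃ x : F, x ^ k = -1) {b : ℝ}
    (hb : b ^ 2 = Fintype.card F) (hkb : (k : ℝ) ≤ |b| + 1)
    (hval : ∀ a : Fˣ, powSum ψ k (a : F) = (b : ℂ) ∨
      powSum ψ k (a : F) = ((-(b * (k - 1)) : ℝ) : ℂ)) :
    (Equienergetic (gpGraph F k) (gpGraph F k)ᶜ ↔ b < 0) ∧
      ¬ Isospectral (gpGraph F k) (gpGraph F k)ᶜ := by
  have hk0 : k ≠ 0 := by omega
  have hK : (2 : ℝ) < k := by exact_mod_cast hk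
  have hKpos : (0 : ℝ) < k := by linarith
  have hq1 : (1 : ℝ) < Fintype.card F := by exact_mod_cast Fintype.one_lt_card
  have hb0 : b ≠ 0 := by rintro rfl; norm_num at hb; linarith
  have hreal : ∀ a : F, ∃ m : ℝ, (m : ℂ) = powSum ψ k a := by
    intro a
    by_cases ha : a = 0
    · exact ⟨Fintype.card F, by rw [ha, powSum_zero]; simp⟩
    · rcases hval (Units.mk0 a ha) with h | h
      · exact ⟨_, h.symm⟩
      · exact ⟨_, h.symm⟩
  choose μ hμ using hreal
  have hμ0 : μ 0 = Fintype.card F := by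
    have := hμ 0
    rw [powSum_zero] at this
    exact_mod_cast this
  have hμval : ∀ a : Fˣ, μ a = b ∨ μ a = -(b * (k - 1)) := fun a =>
    (hval a).imp (fun h => Complex.ofReal_injective ((hμ a).trans h))
      (fun h => Complex.ofReal_injective ((hμ a).trans h))
  have hμsum : ∑ a : Fˣ, μ a = 0 := by
    have := sum_units_powSum hψ hk0
    simp_rw [← hμ] at this
    exact_mod_cast this
  obtain ⟨n, hn⟩ := hdvd
  have hcardU : Fintype.card Fˣ = k * n := by rw [Fintype.card_units, hn]
  have hn' : (Fintype.card Fˣ : ℝ) = k * n := by exact_mod_cast hcardU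
  have hq : (Fintype.card F : ℝ) = k * n + 1 := by
    have : Fintype.card F = k * n + 1 := by
      have := Fintype.card_pos (α := F)
      omega
    exact_mod_cast this
  have hnpos : (0 : ℝ) < n := by
    rw [hq] at hq1
    exact pos_of_mul_pos_right (by linarith : (0 : ℝ) < k * n) hKpos.le
  have htwo := sum_units_comp_of_two_valued hb0 hKpos.ne' hμval hμsum hn'
  have hspec := graphSpectrum_gpGraph hψ hk0 (Dvd.intro _ hn.symm) hneg hμ
  have hspec' := graphSpectrum_gpGraph_compl hψ hk0 (Dvd.intro _ hn.symm) hneg hμ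
  have hb' : b ^ 2 = k * n + 1 := hb.trans hq
  refine ⟨?_, fun hiso => ?_⟩
  · have e1 : graphEnergy (gpGraph F k) = n + n * ((k - 1) * |b - 1| + |-(b * (k - 1)) - 1|) / k := by
      rw [graphEnergy_eq_sum hspec, Fintype.sum_eq_add_sum_units,
        htwo (fun x => |(x - 1) / k|), hμ0, hq, add_sub_cancel_right, abs_div, abs_div, abs_div,
        abs_of_pos hKpos, abs_of_pos (mul_pos hKpos hnpos)]
      field_simp
    have e2 : graphEnergy (gpGraph F k)ᶜ =
        (k - 1) * n + n * ((k - 1) * |k - 1 + b| + |k - 1 + -(b * (k - 1))|) / k := by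
      rw [graphEnergy_eq_sum hspec', Fintype.sum_eq_add_sum_units]
      simp only [Units.ne_zero, if_false, if_true, zero_sub, abs_neg]
      rw [htwo (fun x => |(k - 1 + x) / k|), hμ0, hq, abs_div, abs_div, abs_of_pos hKpos]
      have : (k * n + 1 - (k - 1 + (k * n + 1)) / k : ℝ) = (k - 1) * n := by
        field_simp; ring
      rw [this, abs_of_pos (mul_pos (by linarith) hnpos)]
      field_simp
    rw [Equienergetic, e1, e2]
    rcases hb0.lt_or_gt with hneg | hpos
    · simp only [hneg, iff_true]
      -- The bound `k - 1 ≤ |b|` decides the sign of `k - 1 + b`.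
      rw [abs_of_neg hneg] at hkb
      rw [abs_of_neg (by linarith : b - 1 < 0), abs_of_nonneg (by nlinarith : 0 ≤ -(b * (k - 1)) - 1),
        abs_of_nonpos (by linarith : k - 1 + b ≤ 0),
        abs_of_nonneg (by nlinarith : 0 ≤ k - 1 + -(b * (k - 1)))]
      field_simp
      ring
    · rw [abs_of_pos hpos] at hkb
      have : ¬ b < 0 := not_lt.mpr hpos.le
      simp only [this, iff_false]
      rw [abs_of_nonneg (by linarith : 0 ≤ b - 1),
        abs_of_nonpos (by nlinarith : -(b * (k - 1)) - 1 ≤ 0),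
        abs_of_nonneg (by linarith : 0 ≤ k - 1 + b),
        abs_of_nonpos (by nlinarith : k - 1 + -(b * (k - 1)) ≤ 0)]
      -- For `b > 0` the energies differ by `2 * n * (k - 2)`.
      intro h
      field_simp at h
      have : (k : ℝ) * (k - 2) = 0 := by linear_combination -h / 2
      rcases mul_eq_zero.mp this with h | h <;> linarith
  -- Second moments are `q` times the degrees, here `n` and `(k - 1) * n`, which differ as `k > 2`.
  · have h := Isospectral.sum_eq hspec hspec' hiso (fun x => x ^ 2)
    rw [Fintype.sum_eq_add_sum_units (F := F), Fintype.sum_eq_add_sum_units (F := F)] at h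
    simp only [Units.ne_zero, if_false, if_true, zero_sub] at h
    rw [htwo (fun x => ((x - 1) / k) ^ 2), htwo (fun x => (-((k - 1 + x) / k)) ^ 2), hμ0, hq] at h
    field_simp at h
    have : b ^ 2 * (k - 2) * (n * k ^ 2) = 0 := by
      linear_combination -h + (n * k * (k - 1) ^ 2 - n * k) * hb'
    have hpos : 0 < b ^ 2 * (k - 2) * (n * k ^ 2) :=
      mul_pos (mul_pos (by positivity) (by linarith)) (by positivity)
    exact hpos.ne' this

end Energy

theorem mainTheorem12 {F : Type*} [Field F] [Fintype F] (p m k t : ℕ)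
    (hp : p.Prime) (hF : Fintype.card F = p ^ m)
    (hsemi : IsSemiprimitive k p m) (hk : 2 < k)
    (ht : IsLeast {j : ℕ | k ∣ p ^ j + 1} t) :
    2 * t ∣ m ∧
      ((Equienergetic (gpGraph F k) (gpGraph F k)ᶜ ∧
          ¬ Isospectral (gpGraph F k) (gpGraph F k)ᶜ) ↔
        Odd (m / (2 * t))) := by
  classical
  have : Fact p.Prime := ⟨hp⟩
  have : CharP F p := charP_of_card_eq_prime_pow hF
  have hm : m ≠ 0 := by
    rintro rfl
    have := Fintype.one_lt_card (α := F)
    rw [hF, pow_zero] at this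
    omega
  have htk : k ∣ p ^ t + 1 := ht.1
  have ht0 : t ≠ 0 := by
    rintro rfl
    rw [pow_zero] at htk
    have := Nat.le_of_dvd (by norm_num) htk
    omega
  obtain ⟨-, ⟨m', hm'⟩, ⟨j, hjm, hjk⟩, -⟩ := hsemi.resolve_left fun h => by omega
  have htm : 2 * t ∣ m := by
    have htj := (ht.dvd_of_dvd_pow_add_one ht0 hjk).trans hjm
    have hhalf : 2 * (m / 2) = m := by omega
    rw [← hhalf]
    exact Nat.mul_dvd_mul_left 2 htj
  refine ⟨htm, ?_⟩
  obtain ⟨s, rfl⟩ := htm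
  have hs0 : s ≠ 0 := by rintro rfl; simp at hm
  rw [Nat.mul_div_cancel_left _ (by omega)]
  have hcard : Fintype.card F = (p ^ t) ^ (2 * s) := by rw [hF, ← pow_mul]; ring_nf
  have hQ : 2 ≤ p ^ t := hp.two_le.trans (Nat.le_self_pow ht0 p)
  obtain ⟨r, hr⟩ : p ^ t * p ^ t - 1 ∣ (p ^ t * p ^ t) ^ s - 1 := by
    simpa using Nat.sub_dvd_pow_sub_pow (p ^ t * p ^ t) 1 s
  have hr' : Fintype.card F = (p ^ t * p ^ t - 1) * r + 1 := by
    rw [← hr, hcard, pow_mul, sq, Nat.sub_add_cancel (Nat.one_le_pow _ _ (by positivity))]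
  obtain ⟨d, hd⟩ := htk
  have hdvd : k ∣ Fintype.card F - 1 := by
    rw [hr', Nat.add_sub_cancel, ← sq, ← one_pow 2, Nat.sq_sub_sq, hd, mul_assoc, mul_assoc]
    exact dvd_mul_right _ _
  have hneg : ∃ x : F, x ^ k = -1 := by
    obtain ⟨x, hx⟩ := exists_pow_eq_neg_one (F := F) hr'
    exact ⟨x ^ d, by rw [← pow_mul, mul_comm, ← hd, hx]⟩
  obtain ⟨ψ, hψ, hfrob⟩ := exists_primitive_addChar_frobenius (F := F) p
  have hQpos : (0 : ℝ) < ((p ^ t : ℕ) : ℝ) ^ s := by positivity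
  have key := equienergetic_iff_and_not_isospectral hψ hk hdvd hneg
    (b := (-1) ^ s * ((p ^ t : ℕ) : ℝ) ^ s)
    (by rw [mul_pow, ← pow_mul, ← pow_mul, mul_comm s 2, pow_mul, hcard]; push_cast; simp)
    (by
      rw [abs_mul, abs_pow, abs_neg, abs_one, one_pow, one_mul, abs_of_pos hQpos]
      -- Since `s ≥ 1`, the bound `k ≤ p ^ t + 1` suffices.
      have : k ≤ (p ^ t) ^ s + 1 :=
        (Nat.le_of_dvd (by positivity) ⟨d, hd⟩).trans (Nat.add_le_add_right (Nat.le_self_pow hs0 _) 1)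
      exact_mod_cast this)
    (fun a => by
      have := powSum_semiprimitive hψ hfrob ht0 hd.symm hcard hr' a
      push_cast at this ⊢
      exact this)
  rw [key.1, and_iff_left key.2]
  rcases Nat.even_or_odd s with h | h
  · simp only [h.neg_one_pow, one_mul, Nat.not_odd_iff_even.mpr h, iff_false, not_lt]
    exact hQpos.le
  · simp only [h.neg_one_pow, h, iff_true]
    linarith
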